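/- Let $m,n,p\ge 0$ be integers and let $A\in\mathbb{C}^{m\times n}$, $B\in\mathbb{C}^{m\times p}$, $C\in\mathbb{C}^{p\times n}$ be given. Write $r(\cdot)$ for the rank of a matrix, and let $X$ range over the set $\mathbb{C}^{p\times p}_p$ of $p\times p$ complex matrices of rank $p$ (that is, the nonsingular ones). Then the following maximum and minimum are attained and $$\max_{X\in\mathbb{C}^{p\times p}_p} r(A+BXC)=\min\left\{\, r[A,\ B],\ \ r\begin{bmatrix}A\\ C\end{bmatrix}\right\},$$ $$\min_{X\in\mathbb{C}^{p\times p}_p} r(A+BXC)=\max\left\{\, r[A,\ B]+r\begin{bmatrix}A\\ C\end{bmatrix}-r\begin{bmatrix}A&B\\ C&0\end{bmatrix},\ \ r[A,\ B]+r\begin{bmatrix}A\\ C\end{bmatrix}-r(A)-p\right\}.$$ -/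

import Mathlib

/-! For nonsingular `X` put `A' = A + B * X * C`. Replacing `A` by `A'` leaves the ranks of `[A,
B]`, `[A; C]` and `[A, B; C, 0]` unchanged. The upper bound follows, and the Frobenius inequality
for `[A', B; C, Y]` gives the two lower bounds: one from `Y = 0`, the other from `Y = X⁻¹`, where
the block has rank `p + r(A)`. Both bounds are attained by an extremality argument: if an optimal
`X` missed its bound, a rank-one update of `X`, still nonsingular, would improve the rank
(`exists_rank_lt_add`, `exists_rank_add_lt`). -/

namespace Matrix

variable {K m n p q : Type*} [Field K] [Fintype n]

theorem rank_add_finrank_ker (A : Matrix m n K) :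
    A.rank + Module.finrank K (LinearMap.ker A.mulVecLin) = Fintype.card n := by
  simpa [Matrix.rank] using A.mulVecLin.finrank_range_add_finrank_ker

theorem rank_le_rank_of_ker_le {A : Matrix m n K} {B : Matrix p n K}
    (h : LinearMap.ker A.mulVecLin ≤ LinearMap.ker B.mulVecLin) : B.rank ≤ A.rank := by
  have h1 := rank_add_finrank_ker A
  have h2 := rank_add_finrank_ker B
  have h3 := Submodule.finrank_mono h
  omega

theorem rank_lt_rank_of_ker_lt {A : Matrix m n K} {B : Matrix p n K}
    (h : LinearMap.ker A.mulVecLin < LinearMap.ker B.mulVecLin) : B.rank < A.rank := by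
  have h1 := rank_add_finrank_ker A
  have h2 := rank_add_finrank_ker B
  have h3 := Submodule.finrank_lt_finrank_of_lt h
  omega

/-- Stacking `Q` below `P` adds to the rank the dimension of the image of `ker P` under `Q`. -/
theorem rank_fromRows_eq (P : Matrix m n K) (Q : Matrix p n K) :
    (fromRows P Q).rank =
      P.rank + Module.finrank K ((LinearMap.ker P.mulVecLin).map Q.mulVecLin) := by
  have h1 := rank_add_finrank_ker (fromRows P Q)
  have h2 := rank_add_finrank_ker P
  have h3 := (Q.mulVecLin.domRestrict (LinearMap.ker P.mulVecLin)).finrank_range_add_finrank_ker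
  rw [LinearMap.range_domRestrict, LinearMap.ker_domRestrict] at h3
  have h4 : LinearMap.ker (fromRows P Q).mulVecLin =
      LinearMap.ker P.mulVecLin ⊓ LinearMap.ker Q.mulVecLin := by
    ext x
    simp [fromRows_mulVec, ← Sum.elim_zero_zero, Sum.elim_eq_iff]
  have h5 : Module.finrank K ((LinearMap.ker Q.mulVecLin).comap
      (LinearMap.ker P.mulVecLin).subtype) =
      Module.finrank K (LinearMap.ker (fromRows P Q).mulVecLin) := by
    rw [h4, ← Submodule.map_comap_subtype]
    exact (Submodule.equivMapOfInjective _ (Submodule.injective_subtype _) _).finrank_eq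
  omega

/-! ### Bordered matrices. -/

variable [Fintype p]

theorem map_ker_le_map_ker_fromCols (A : Matrix m n K) (B : Matrix m p K) (C : Matrix q n K)
    (Y : Matrix q p K) :
    (LinearMap.ker A.mulVecLin).map C.mulVecLin ≤
      (LinearMap.ker (fromCols A B).mulVecLin).map (fromCols C Y).mulVecLin := by
  rintro _ ⟨x, hx, rfl⟩
  refine ⟨Sum.elim x 0, ?_, ?_⟩
  · simpa [fromCols_mulVec_sumElim] using hx
  · simp

/-- Schur complement: the kernel of the block matrix is the graph of `x ↦ -(X * C) *ᵥ x` over the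
kernel of `A - B * X * C`. -/
theorem rank_fromBlocks_inv [DecidableEq p] (A : Matrix m n K) (B : Matrix m p K)
    (C : Matrix p n K) {X : Matrix p p K} (hX : X.det ≠ 0) :
    (fromBlocks A B C X⁻¹).rank = Fintype.card p + (A - B * X * C).rank := by
  have hX' : IsUnit X.det := isUnit_iff_ne_zero.mpr hX
  let φ : (n → K) →ₗ[K] (n ⊕ p → K) :=
    { toFun := fun x => Sum.elim x (-((X * C) *ᵥ x))
      map_add' := fun x y => by
        rw [← Sum.elim_add_add, mulVec_add, neg_add]
      map_smul' := fun c x => by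
        ext (i | i) <;> simp [mulVec_smul] }
  have hφ : Function.Injective φ := fun x y hxy => by
    ext i
    exact congrFun hxy (Sum.inl i)
  have hker : LinearMap.ker (fromBlocks A B C X⁻¹).mulVecLin =
      (LinearMap.ker (A - B * X * C).mulVecLin).map φ := by
    ext u
    simp only [LinearMap.mem_ker, mulVecLin_apply, fromBlocks_mulVec, Submodule.mem_map]
    rw [← Sum.elim_zero_zero, Sum.elim_eq_iff]
    constructor
    · rintro ⟨h1, h2⟩
      have hz : u ∘ Sum.inr = -((X * C) *ᵥ (u ∘ Sum.inl)) := by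
        have := congrArg (X *ᵥ ·) h2
        simp only [mulVec_add, mulVec_mulVec, mul_nonsing_inv _ hX', one_mulVec, mulVec_zero]
          at this
        exact eq_neg_of_add_eq_zero_right this
      refine ⟨u ∘ Sum.inl, ?_, ?_⟩
      · rw [hz, mulVec_neg, mulVec_mulVec, ← Matrix.mul_assoc] at h1
        rw [sub_mulVec, sub_eq_add_neg, h1]
      · change Sum.elim (u ∘ Sum.inl) (-((X * C) *ᵥ (u ∘ Sum.inl))) = u
        rw [← hz, Sum.elim_comp_inl_inr]
    · rintro ⟨x, hx, rfl⟩
      have h1 : φ x ∘ Sum.inl = x := rfl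
      have h2 : φ x ∘ Sum.inr = -((X * C) *ᵥ x) := rfl
      rw [h1, h2, mulVec_neg, mulVec_neg, mulVec_mulVec, mulVec_mulVec,
        nonsing_inv_mul_cancel_left _ _ hX', ← Matrix.mul_assoc, ← sub_eq_add_neg, ← sub_mulVec]
      exact ⟨hx, add_neg_cancel _⟩
  have h1 := rank_add_finrank_ker (fromBlocks A B C X⁻¹)
  have h2 := rank_add_finrank_ker (A - B * X * C)
  rw [hker, ← (Submodule.equivMapOfInjective φ hφ _).finrank_eq, Fintype.card_sum] at h1
  omega

theorem rank_fromCols_add_mul (A : Matrix m n K) (B : Matrix m p K) (D : Matrix p n K) :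
    (fromCols (A + B * D) B).rank = (fromCols A B).rank := by
  classical
  have key : ∀ (A : Matrix m n K) (D : Matrix p n K),
      (fromCols (A + B * D) B).rank ≤ (fromCols A B).rank := fun A D => by
    have : fromCols (A + B * D) B =
        fromCols A B * (fromBlocks 1 0 D 1 : Matrix (n ⊕ p) (n ⊕ p) K) := by
      rw [fromCols_mul_fromBlocks]; simp
    rw [this]
    exact rank_mul_le_left _ _
  refine le_antisymm (key A D) ?_
  simpa [add_assoc] using key (A + B * D) (-D)

/-- Frobenius-type rank inequality for a bordered matrix. -/
theorem rank_fromCols_add_rank_fromRows_le (A : Matrix m n K) (B : Matrix m p K)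
    (C : Matrix q n K) (Y : Matrix q p K) :
    (fromCols A B).rank + (fromRows A C).rank ≤ A.rank + (fromBlocks A B C Y).rank := by
  have h := Submodule.finrank_mono (map_ker_le_map_ker_fromCols A B C Y)
  rw [← fromRows_fromCols_eq_fromBlocks, rank_fromRows_eq A C,
    rank_fromRows_eq (fromCols A B)]
  omega

theorem rank_fromBlocks_add_mul (A : Matrix m n K) (B : Matrix m p K) (C : Matrix q n K)
    (D : Matrix p n K) :
    (fromBlocks (A + B * D) B C 0).rank = (fromBlocks A B C (0 : Matrix q p K)).rank := by
  have h := rank_fromCols_add_mul (fromRows A C) (fromRows B (0 : Matrix q p K)) D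
  have h' : fromRows A C + fromRows B (0 : Matrix q p K) * D = fromRows (A + B * D) C := by
    rw [fromRows_mul]
    ext (i | i) j <;> simp
  rw [h'] at h
  simpa only [fromCols_fromRows_eq_fromBlocks] using h

/-! ### Rank-one updates and the Frobenius equality case. -/

/-- Since `u` is outside the column space of `A`, the new kernel is contained in that of `A` and
orthogonal to `v`, so it loses `x₀`. -/
theorem rank_lt_rank_add_vecMulVec {A : Matrix m n K} {u : m → K} {v : n → K}
    (hu : ∀ x, A *ᵥ x ≠ u) {x₀ : n → K} (hx : A *ᵥ x₀ = 0) (hv : v ⬝ᵥ x₀ ≠ 0) :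
    A.rank < (A + vecMulVec u v).rank := by
  have key : ∀ x, (A + vecMulVec u v) *ᵥ x = 0 → v ⬝ᵥ x = 0 := fun x h => by
    by_contra hne
    rw [add_mulVec, vecMulVec_mulVec, op_smul_eq_smul] at h
    refine hu (-(v ⬝ᵥ x)⁻¹ • x) ?_
    rw [mulVec_smul, eq_neg_of_add_eq_zero_left h, smul_neg, neg_smul, neg_neg, smul_smul,
      inv_mul_cancel₀ hne, one_smul]
  apply rank_lt_rank_of_ker_lt
  refine lt_of_le_of_ne (fun x h => ?_) fun heq => hv (key _ ?_)
  · have h0 := key x h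
    simpa [add_mulVec, vecMulVec_mulVec, h0] using h
  · have : x₀ ∈ LinearMap.ker A.mulVecLin := hx
    rw [← heq] at this
    exact this

variable [Fintype m] [Fintype q]

theorem exists_vecMul_eq_of_ker_le {A : Matrix m n K} {v : n → K}
    (h : ∀ x, A *ᵥ x = 0 → v ⬝ᵥ x = 0) : ∃ y, y ᵥ* A = v := by
  classical
  have hv : dotProductBilin K K v ∈ LinearMap.range A.mulVecLin.dualMap := by
    rw [LinearMap.range_dualMap_eq_dualAnnihilator_ker, Submodule.mem_dualAnnihilator]
    intro x hx
    exact h x hx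
  obtain ⟨φ, hφ⟩ := hv
  obtain ⟨y, rfl⟩ := (dotProductEquiv K m).surjective φ
  refine ⟨y, dotProduct_eq _ _ fun x => ?_⟩
  rw [← dotProduct_mulVec]
  exact LinearMap.congr_fun hφ x

theorem exists_dotProduct_ne_zero_of_notMem {S : Submodule K (p → K)} {t : p → K} (ht : t ∉ S) :
    ∃ w : p → K, w ⬝ᵥ t ≠ 0 ∧ ∀ s ∈ S, w ⬝ᵥ s = 0 := by
  classical
  obtain ⟨φ, h1, h2⟩ := Submodule.exists_dual_map_eq_bot_of_notMem ht inferInstance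
  obtain ⟨w, rfl⟩ := (dotProductEquiv K p).surjective φ
  refine ⟨w, h1, fun s hs => ?_⟩
  have : dotProductEquiv K p w s ∈ S.map (dotProductEquiv K p w) := ⟨s, hs, rfl⟩
  rw [h2] at this
  exact this

/-- The equality case of `rank_fromCols_add_rank_fromRows_le`. -/
theorem rank_add_rank_fromBlocks_le {A : Matrix m n K} {B : Matrix m p K}
    {C : Matrix q n K} {Y : Matrix q p K}
    (h : ∀ x z y w, A *ᵥ x = B *ᵥ z → y ᵥ* A = w ᵥ* C → y ⬝ᵥ A *ᵥ x = w ⬝ᵥ Y *ᵥ z) :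
    A.rank + (fromBlocks A B C Y).rank ≤ (fromCols A B).rank + (fromRows A C).rank := by
  have hle : (LinearMap.ker (fromCols A B).mulVecLin).map (fromCols C Y).mulVecLin ≤
      (LinearMap.ker A.mulVecLin).map C.mulVecLin := by
    rintro _ ⟨u, hu, rfl⟩
    -- A functional `w` separates the vector from `C (ker A)`. Then `w ᵥ* C` kills `ker A`, hence is
    -- some `y ᵥ* A`, and `h` makes `w` vanish on the vector.
    by_contra hcon
    obtain ⟨w, hw, hS⟩ := exists_dotProduct_ne_zero_of_notMem hcon
    obtain ⟨y, hy⟩ : ∃ y, y ᵥ* A = w ᵥ* C := exists_vecMul_eq_of_ker_le fun x hx => by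
      rw [← dotProduct_mulVec]
      exact hS _ ⟨x, hx, rfl⟩
    have hu' : A *ᵥ (u ∘ Sum.inl) + B *ᵥ (u ∘ Sum.inr) = 0 := by
      simpa [fromCols_mulVec] using hu
    have := h (u ∘ Sum.inl) (-(u ∘ Sum.inr)) y w
      (by rw [mulVec_neg]; exact eq_neg_of_add_eq_zero_left hu') hy
    apply hw
    rw [dotProduct_mulVec, hy, ← dotProduct_mulVec, mulVec_neg, dotProduct_neg] at this
    simp [fromCols_mulVec, dotProduct_add, this]
  have h' := Submodule.finrank_mono hle
  rw [← fromRows_fromCols_eq_fromBlocks, rank_fromRows_eq A C,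
    rank_fromRows_eq (fromCols A B)]
  omega

theorem rank_fromRows_add_mul (A : Matrix m n K) (C : Matrix p n K) (D : Matrix m p K) :
    (fromRows (A + D * C) C).rank = (fromRows A C).rank := by
  rw [← rank_transpose, ← rank_transpose (fromRows A C), transpose_fromRows, transpose_fromRows,
    transpose_add, transpose_mul, rank_fromCols_add_mul]

theorem det_add_vecMulVec [DecidableEq p] {X : Matrix p p K} (hX : X.det ≠ 0) (z w : p → K) :
    (X + vecMulVec z w).det = X.det * (1 + w ⬝ᵥ X⁻¹ *ᵥ z) := by
  rw [vecMulVec_eq Unit, det_add_replicateCol_mul_replicateRow (isUnit_iff_ne_zero.mpr hX)]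
  congr 1
  rw [Matrix.mul_assoc, ← replicateCol_mulVec, det_unique]
  rfl

/-- Wedderburn's rank reduction. -/
theorem rank_sub_smul_vecMulVec_lt {A : Matrix m n K} {x : n → K} {y : m → K}
    (h : y ⬝ᵥ A *ᵥ x ≠ 0) :
    (A - (y ⬝ᵥ A *ᵥ x)⁻¹ • vecMulVec (A *ᵥ x) (y ᵥ* A)).rank < A.rank := by
  apply rank_lt_rank_of_ker_lt
  refine lt_of_le_of_ne (fun x' h' => ?_) fun heq => ?_
  · have h0 : A *ᵥ x' = 0 := h'
    simp [vecMulVec_mulVec, ← dotProduct_mulVec, h0]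
  · have hx : x ∈ LinearMap.ker
        (A - (y ⬝ᵥ A *ᵥ x)⁻¹ • vecMulVec (A *ᵥ x) (y ᵥ* A)).mulVecLin := by
      simp [vecMulVec_mulVec, ← dotProduct_mulVec, smul_smul, h]
    rw [← heq] at hx
    have hx' : A *ᵥ x = 0 := hx
    simp [hx'] at h

end Matrix

/-- A vector space is not the union of two proper subspaces: if `f a ≠ 0` and `g b ≠ 0`, neither map
vanishes at `a + b`. -/
theorem LinearMap.eq_zero_or_eq_zero_of_apply {K V W : Type*} [Semiring K] [AddCommGroup V]
    [Module K V] [AddCommGroup W] [Module K W] {f g : V →ₗ[K] W}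
    (h : ∀ v, f v = 0 ∨ g v = 0) : f = 0 ∨ g = 0 := by
  by_contra! hne
  obtain ⟨a, ha⟩ := DFunLike.ne_iff.mp hne.1
  obtain ⟨b, hb⟩ := DFunLike.ne_iff.mp hne.2
  simp only [LinearMap.zero_apply] at ha hb
  have ga := (h a).resolve_left ha
  have fb := (h b).resolve_right hb
  rcases h (a + b) with h0 | h0
  · simp [fb, ha] at h0
  · simp [ga, hb] at h0

/-- If the product of two bilinear forms vanishes identically, so does one of the forms. -/
theorem LinearMap.eq_zero_or_eq_zero_of_bilin {K V W : Type*} [Field K] [AddCommGroup V]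
    [Module K V] [AddCommGroup W] [Module K W] {f g : V →ₗ[K] W →ₗ[K] K}
    (h : ∀ v w, f v w = 0 ∨ g v w = 0) : f = 0 ∨ g = 0 := by
  exact eq_zero_or_eq_zero_of_apply fun v => eq_zero_or_eq_zero_of_apply (h v)

/-! ### Improving a nonsingular `X` by a rank-one update. -/

namespace Matrix

variable {K m n p : Type*} [Field K] [Fintype m] [Fintype n] [Fintype p] [DecidableEq p]

theorem exists_rank_lt_add [CharZero K] (A : Matrix m n K) (B : Matrix m p K) (C : Matrix p n K)
    {X : Matrix p p K} (hX : X.det ≠ 0)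
    (h1 : (A + B * X * C).rank < (fromCols A B).rank)
    (h2 : (A + B * X * C).rank < (fromRows A C).rank) :
    ∃ X' : Matrix p p K, X'.det ≠ 0 ∧ (A + B * X * C).rank < (A + B * X' * C).rank := by
  rw [← rank_fromCols_add_mul A B (X * C), ← Matrix.mul_assoc] at h1
  rw [← rank_fromRows_add_mul A C (B * X)] at h2
  set A' := A + B * X * C with hA'
  obtain ⟨z, hz⟩ : ∃ z, ∀ x, A' *ᵥ x ≠ B *ᵥ z := by
    by_contra! hcon
    refine h1.not_ge (Submodule.finrank_mono ?_)
    rintro _ ⟨u, rfl⟩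
    obtain ⟨x, hx⟩ := hcon (u ∘ Sum.inr)
    exact ⟨u ∘ Sum.inl + x, by simp [fromCols_mulVec, mulVec_add, hx]⟩
  obtain ⟨x₀, hx₀, hC⟩ : ∃ x, A' *ᵥ x = 0 ∧ C *ᵥ x ≠ 0 := by
    by_contra! hcon
    refine h2.not_ge (rank_le_rank_of_ker_le fun x hx => ?_)
    have hx' : A' *ᵥ x = 0 := hx
    simp [fromRows_mulVec, hx', hcon x hx']
  obtain ⟨j, hj⟩ := Function.ne_iff.mp hC
  -- The scale `t` keeps the updated determinant nonzero; when `t = 1` fails, `t = -1` gives `2`,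
  -- nonzero in characteristic zero.
  obtain ⟨t, ht, hdet⟩ : ∃ t : K, t ≠ 0 ∧
      1 + Pi.single j 1 ⬝ᵥ X⁻¹ *ᵥ (t • z) ≠ 0 := by
    simp only [mulVec_smul, dotProduct_smul, smul_eq_mul]
    generalize Pi.single j 1 ⬝ᵥ X⁻¹ *ᵥ z = s
    by_cases hs : 1 + s = 0
    · refine ⟨-1, by simp, ?_⟩
      have : s = -1 := by linear_combination hs
      rw [this]; norm_num
    · exact ⟨1, one_ne_zero, by simpa using hs⟩
  refine ⟨X + vecMulVec (t • z) (Pi.single j 1), ?_, ?_⟩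
  · rw [det_add_vecMulVec hX]
    exact mul_ne_zero hX hdet
  · have : A + B * (X + vecMulVec (t • z) (Pi.single j 1)) * C =
        A' + vecMulVec (B *ᵥ (t • z)) (Pi.single j 1 ᵥ* C) := by
      rw [Matrix.mul_add, Matrix.add_mul, mul_vecMulVec, vecMulVec_mul, hA', add_assoc]
    rw [this]
    refine rank_lt_rank_add_vecMulVec (fun x hx => hz (t⁻¹ • x) ?_) hx₀ ?_
    · rw [mulVec_smul, hx, mulVec_smul, inv_smul_smul₀ ht]
    · rw [← dotProduct_mulVec]
      simpa using hj

theorem exists_rank_add_lt (A : Matrix m n K) (B : Matrix m p K) (C : Matrix p n K)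
    {X : Matrix p p K} (hX : X.det ≠ 0)
    (h1 : (fromCols A B).rank + (fromRows A C).rank <
      (A + B * X * C).rank + (fromBlocks A B C 0).rank)
    (h2 : (fromCols A B).rank + (fromRows A C).rank <
      (A + B * X * C).rank + (Fintype.card p + A.rank)) :
    ∃ X' : Matrix p p K, X'.det ≠ 0 ∧ (A + B * X' * C).rank < (A + B * X * C).rank := by
  have h3 := rank_fromBlocks_inv (A + B * X * C) B C hX
  rw [add_sub_cancel_right] at h3
  rw [← h3] at h2
  rw [← rank_fromBlocks_add_mul A B C (X * C), ← Matrix.mul_assoc] at h1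
  rw [← rank_fromCols_add_mul A B (X * C), ← rank_fromRows_add_mul A C (B * X),
    ← Matrix.mul_assoc] at h1 h2
  set A' := A + B * X * C with hA'
  let U := LinearMap.ker (A'.mulVecLin.coprod (-B.mulVecLin))
  let V := LinearMap.ker (A'.vecMulLinear.coprod (-C.vecMulLinear))
  let b₁ : V →ₗ[K] U →ₗ[K] K :=
    ((dotProductBilin K K).compl₁₂ (LinearMap.fst K (m → K) (p → K) ∘ₗ V.subtype)
      (A'.mulVecLin ∘ₗ LinearMap.fst K (n → K) (p → K) ∘ₗ U.subtype))
  let b₂ : V →ₗ[K] U →ₗ[K] K :=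
    ((dotProductBilin K K).compl₁₂ (LinearMap.snd K (m → K) (p → K) ∘ₗ V.subtype)
      (X⁻¹.mulVecLin ∘ₗ LinearMap.snd K (n → K) (p → K) ∘ₗ U.subtype))
  have memU : ∀ {x z}, A' *ᵥ x = B *ᵥ z → (x, z) ∈ U := fun {x z} h => by simp [U, h]
  have memV : ∀ {y w}, y ᵥ* A' = w ᵥ* C → (y, w) ∈ V := fun {y w} h => by simp [V, h]
  -- If `b₁ = 0` or `b₁ = b₂`, the Frobenius inequality is an equality for corner `0` or `X⁻¹`
  -- respectively, contradicting `h1` or `h2`.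
  obtain ⟨v, u, hne, hne'⟩ : ∃ v u, b₁ v u ≠ 0 ∧ (b₁ - b₂) v u ≠ 0 := by
    by_contra! hcon
    rcases LinearMap.eq_zero_or_eq_zero_of_bilin (f := b₁) (g := b₁ - b₂)
      (fun v u => or_iff_not_imp_left.mpr (hcon v u)) with h0 | h0
    · refine h1.not_ge (rank_add_rank_fromBlocks_le fun x z y w hx hy => ?_)
      rw [zero_mulVec, dotProduct_zero]
      exact LinearMap.congr_fun₂ h0 ⟨_, memV hy⟩ ⟨_, memU hx⟩
    · refine h2.not_ge (rank_add_rank_fromBlocks_le fun x z y w hx hy => ?_)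
      exact sub_eq_zero.mp (LinearMap.congr_fun₂ h0 ⟨_, memV hy⟩ ⟨_, memU hx⟩)
  obtain ⟨⟨y, w⟩, hv⟩ := v
  obtain ⟨⟨x, z⟩, hu⟩ := u
  replace hu : A' *ᵥ x = B *ᵥ z := by simpa [U, ← sub_eq_add_neg, sub_eq_zero] using hu
  replace hv : y ᵥ* A' = w ᵥ* C := by simpa [V, ← sub_eq_add_neg, sub_eq_zero] using hv
  replace hne : y ⬝ᵥ A' *ᵥ x ≠ 0 := hne
  replace hne' : y ⬝ᵥ A' *ᵥ x - w ⬝ᵥ X⁻¹ *ᵥ z ≠ 0 := hne'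
  -- As `B *ᵥ z = A' *ᵥ x` and `w ᵥ* C = y ᵥ* A'`, this update of `X` is Wedderburn's reduction of
  -- `A'`; `hne'` keeps the determinant nonzero.
  refine ⟨X + vecMulVec (-(y ⬝ᵥ A' *ᵥ x)⁻¹ • z) w, ?_, ?_⟩
  · rw [det_add_vecMulVec hX]
    refine mul_ne_zero hX fun h => hne' ?_
    rw [mulVec_smul, dotProduct_smul, smul_eq_mul] at h
    field_simp at h
    linear_combination h
  · convert rank_sub_smul_vecMulVec_lt hne using 2
    rw [Matrix.mul_add, Matrix.add_mul, mul_vecMulVec, vecMulVec_mul, mulVec_smul, ← hu, ← hv,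
      ← add_assoc, ← hA', smul_vecMulVec, neg_smul, ← sub_eq_add_neg]

theorem det_ne_zero_iff_rank_eq_card {X : Matrix p p K} : X.det ≠ 0 ↔ X.rank = Fintype.card p := by
  refine ⟨rank_of_det_ne_zero, fun h hdet => ?_⟩
  obtain ⟨v, hv, hXv⟩ := exists_mulVec_eq_zero_iff.mpr hdet
  have h1 := rank_add_finrank_ker X
  have h2 : Module.finrank K (LinearMap.ker X.mulVecLin) = 0 := by omega
  rw [Submodule.finrank_eq_zero] at h2
  have h3 : v ∈ LinearMap.ker X.mulVecLin := hXv
  rw [h2] at h3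
  exact hv h3

end Matrix

/-! ### Bounds and attainment over `ℂ`. -/

theorem corollary3p4 (m n p : ℕ) (A : Matrix (Fin m) (Fin n) ℂ) (B : Matrix (Fin m) (Fin p) ℂ)
    (C : Matrix (Fin p) (Fin n) ℂ) :
    IsGreatest
      {r : ℤ | ∃ X : Matrix (Fin p) (Fin p) ℂ, X.rank = p ∧ r = ((A + B * X * C).rank : ℤ)}
      (min ((Matrix.fromCols A B).rank : ℤ) ((Matrix.fromRows A C).rank : ℤ)) ∧
    IsLeast
      {r : ℤ | ∃ X : Matrix (Fin p) (Fin p) ℂ, X.rank = p ∧ r = ((A + B * X * C).rank : ℤ)}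
      (max
        (((Matrix.fromCols A B).rank : ℤ) + ((Matrix.fromRows A C).rank : ℤ)
          - ((Matrix.fromBlocks A B C 0).rank : ℤ))
        (((Matrix.fromCols A B).rank : ℤ) + ((Matrix.fromRows A C).rank : ℤ)
          - (A.rank : ℤ) - (p : ℤ))) := by
  have hset : ∀ X : Matrix (Fin p) (Fin p) ℂ, X.rank = p ↔ X.det ≠ 0 := fun X => by
    rw [Matrix.det_ne_zero_iff_rank_eq_card, Fintype.card_fin]
  have hmul : ∀ X : Matrix (Fin p) (Fin p) ℂ, B * (X * C) = B * X * C := fun X =>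
    (Matrix.mul_assoc B X C).symm
  have hne : {X : Matrix (Fin p) (Fin p) ℂ | X.det ≠ 0}.Nonempty := ⟨1, by simp⟩
  have upper : ∀ X : Matrix (Fin p) (Fin p) ℂ,
      (A + B * X * C).rank ≤ min (Matrix.fromCols A B).rank (Matrix.fromRows A C).rank := by
    intro X
    refine le_min ?_ ?_
    · rw [← Matrix.rank_fromCols_add_mul A B (X * C), hmul]
      refine Submodule.finrank_mono ?_
      rintro _ ⟨x, rfl⟩
      refine ⟨Sum.elim x 0, ?_⟩
      simp only [Matrix.mulVecLin_apply, Matrix.fromCols_mulVec_sumElim, Matrix.mulVec_zero,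
        add_zero]
    · rw [← Matrix.rank_fromRows_add_mul A C (B * X), Matrix.rank_fromRows_eq]
      exact Nat.le_add_right _ _
  have lower₁ : ∀ X : Matrix (Fin p) (Fin p) ℂ,
      (Matrix.fromCols A B).rank + (Matrix.fromRows A C).rank ≤
        (A + B * X * C).rank + (Matrix.fromBlocks A B C 0).rank := by
    intro X
    have h := Matrix.rank_fromCols_add_rank_fromRows_le (A + B * X * C) B C 0
    rwa [← hmul, Matrix.rank_fromBlocks_add_mul, Matrix.rank_fromCols_add_mul, hmul,
      Matrix.rank_fromRows_add_mul] at h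
  have lower₂ : ∀ X : Matrix (Fin p) (Fin p) ℂ, X.det ≠ 0 →
      (Matrix.fromCols A B).rank + (Matrix.fromRows A C).rank ≤
        (A + B * X * C).rank + (p + A.rank) := by
    intro X hX
    have h := Matrix.rank_fromCols_add_rank_fromRows_le (A + B * X * C) B C X⁻¹
    rwa [Matrix.rank_fromBlocks_inv _ _ _ hX, add_sub_cancel_right, Fintype.card_fin,
      Matrix.rank_fromRows_add_mul, ← hmul, Matrix.rank_fromCols_add_mul, hmul] at h
  refine ⟨⟨?_, ?_⟩, ⟨?_, ?_⟩⟩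
  · obtain ⟨X, hX, hmax⟩ : ∃ X : Matrix (Fin p) (Fin p) ℂ, X.det ≠ 0 ∧
        ∀ X' : Matrix (Fin p) (Fin p) ℂ, X'.det ≠ 0 →
          (A + B * X' * C).rank ≤ (A + B * X * C).rank := by
      have hfin : ((fun X => (A + B * X * C).rank) ''
          {X : Matrix (Fin p) (Fin p) ℂ | X.det ≠ 0}).Finite :=
        (Set.finite_Iic _).subset (Set.image_subset_iff.mpr fun X _ => upper X)
      obtain ⟨_, ⟨X, hX, rfl⟩, hmax⟩ := Set.exists_max_image _ id hfin (hne.image _)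
      exact ⟨X, hX, fun X' hX' => hmax _ ⟨X', hX', rfl⟩⟩
    refine ⟨X, (hset X).mpr hX, ?_⟩
    have h := upper X
    have h' : min (Matrix.fromCols A B).rank (Matrix.fromRows A C).rank ≤
        (A + B * X * C).rank := by
      by_contra! hlt
      obtain ⟨X', hX', hlt'⟩ := Matrix.exists_rank_lt_add A B C hX
        (hlt.trans_le (min_le_left _ _)) (hlt.trans_le (min_le_right _ _))
      exact (hmax X' hX').not_gt hlt'
    omega
  · rintro _ ⟨X, -, rfl⟩
    exact_mod_cast upper X
  · obtain ⟨X, hX, hmin⟩ : ∃ X : Matrix (Fin p) (Fin p) ℂ, X.det ≠ 0 ∧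
        ∀ X' : Matrix (Fin p) (Fin p) ℂ, X'.det ≠ 0 →
          (A + B * X * C).rank ≤ (A + B * X' * C).rank := by
      obtain ⟨X, hX, hmin⟩ := Nat.sInf_mem (hne.image fun X => (A + B * X * C).rank)
      exact ⟨X, hX, fun X' hX' => hmin.trans_le (Nat.sInf_le ⟨X', hX', rfl⟩)⟩
    refine ⟨X, (hset X).mpr hX, ?_⟩
    have h1 := lower₁ X
    have h2 := lower₂ X hX
    by_contra hcon
    obtain ⟨X', hX', hlt'⟩ := Matrix.exists_rank_add_lt A B C hX (by omega)
      (by rw [Fintype.card_fin]; omega)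
    exact (hmin X' hX').not_gt hlt'
  · rintro _ ⟨X, hX, rfl⟩
    have h1 := lower₁ X
    have h2 := lower₂ X ((hset X).mp hX)
    omega
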